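/- A machine is in state $0$ (free), $1$ (busy with an internal job) or $2$ (busy with an external job). Let $X(t)$ be its state and $\hat X(t)$ a monitor's estimate of it. Let $\alpha,\beta,\gamma,\lambda>0$ and $\mu\ge 0$. A free machine receives internal jobs at rate $\alpha$; internal jobs are completed at rate $\beta$, external jobs at rate $\gamma$. The monitor samples the machine at rate $\mu$, and then $\hat X$ becomes $X$. External jobs arrive at the monitor at rate $\lambda$; they are rejected if $\hat X\neq 0$. If $\hat X=0$, the job is sent to the machine: if $X=0$, then $(X,\hat X)$ becomes $(2,2)$; if $X=1$, then the job is lost and $(X,\hat X)$ becomes $(1,1)$. Thus $Y(t)=(X(t),\hat X(t))$ is a continuous-time Markov chain on $S=\{0,1\}\times\{0,1\}\cup\{0,1,2\}\times\{2\}$, started at $Y(0)=(0,0)$. Let $C(0,0)=C(1,1)=C(1,2)=C(2,2)=1$ and $C=0$ on the other states (states $1$ and $2$ are deemed equivalent), and let $$\Delta=\limsup_{T\to\infty}\frac1T\int_0^T C(X(t),\hat X(t))\,dt .$$ **Theorem.** For every $\mu>0$ the chain has a unique stationary distribution $\pi^{(\mu)}$. When $\mu=0$, the average freshness $\mathbb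 E[\Delta]$ (with $\Delta$ integrable) is the limit of the formula for $\mu>0$: $$\mathbb E[\Delta]=\lim_{\mu\to0^+}\left(1-\bigl(\pi^{(\mu)}_{10}+\pi^{(\mu)}_{01}+\pi^{(\mu)}_{02}\bigr)\right)=\frac{\alpha}{\alpha+\beta}.$$ Moreover, when $\mu=0$, the chain almost surely leaves the pair of transient states $\{(0,0),(1,0)\}$; for each $s$ in this pair, the event that it first leaves the pair from $s$ has positive probability, and the conditional expectation of $\Delta$ given this event is $\frac{\alpha}{\alpha+\beta}$. -/

import Mathlib

open MeasureTheory ProbabilityTheory Filter Topology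

noncomputable section

/-! ### Continuous-time Markov chains on a finite state space -/

section CTMC

variable {S : Type*} [Fintype S] [DecidableEq S]

/-- The generator matrix with off-diagonal entries `r i j` (the rate of transition from `i` to `j`);
each diagonal entry makes its row sum to zero. The values `r i i` are ignored. -/
def generatorOf (r : S → S → ℝ) : Matrix S S ℝ :=
  fun i j => if i = j then -∑ k ∈ Finset.univ.erase i, r i k else r i j

/-- Total rate of transition out of the state `i`. -/
def exitRate (Q : Matrix S S ℝ) (i : S) : ℝ := -Q i i

/-- Transition matrix of the embedded discrete-time chain of `Q`
(a state with exit rate `0` is absorbing). -/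
def embeddedMatrix (Q : Matrix S S ℝ) : Matrix S S ℝ :=
  fun i j =>
    if exitRate Q i = 0 then (if i = j then 1 else 0)
    else (if i = j then 0 else Q i j / exitRate Q i)

/-- `π` is a stationary distribution of the chain with generator `Q`. -/
def IsStationaryDistr (Q : Matrix S S ℝ) (π : S → ℝ) : Prop :=
  (∀ i, 0 ≤ π i) ∧ ∑ i, π i = 1 ∧ Matrix.vecMul π Q = 0

/-- Time of the `n`-th jump, when the successive states are `Z 0, Z 1, …` and the `k`-th holding
time is `E k` divided by the exit rate of `Z k`. -/
def jumpTime {Ω : Type*} (Q : Matrix S S ℝ) (Z : ℕ → Ω → S) (E : ℕ → Ω → ℝ) (n : ℕ) (ω : Ω) : ℝ :=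
  ∑ k ∈ Finset.range n, E k ω / exitRate Q (Z k ω)

/-- The process `Y` is the jump-and-hold process with embedded chain `Z` and holding times
`E k / exitRate Q (Z k)`, where `Z` is a discrete-time Markov chain started at `x₀` with transition
matrix `embeddedMatrix Q`, and the `E k` are i.i.d. standard exponential and independent of `Z`.
That is, given `Z`, the holding times are independent and exponential with the exit rates of the
visited states as parameters. -/
structure IsJumpHold {Ω : Type*} [MeasurableSpace Ω] [MeasurableSpace S] (P : Measure Ω)
    (Q : Matrix S S ℝ) (x₀ : S) (Z : ℕ → Ω → S) (E : ℕ → Ω → ℝ) (Y : ℝ → Ω → S) : Prop where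
  measurable_chain : ∀ n, Measurable (Z n)
  measurable_clock : ∀ n, Measurable (E n)
  /-- Law of the embedded chain. -/
  chain_law : ∀ (n : ℕ) (z : ℕ → S),
    P.real {ω | ∀ k ≤ n, Z k ω = z k} =
      (if z 0 = x₀ then 1 else 0) * ∏ k ∈ Finset.range n, embeddedMatrix Q (z k) (z (k + 1))
  clock_law : ∀ n, P.map (E n) = expMeasure 1
  clock_indep : iIndepFun E P
  clock_indep_chain : IndepFun (fun ω n => E n ω) (fun ω n => Z n ω) P
  /-- From the `n`-th jump time on, for the `n`-th holding time, the process sits at `Z n`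
  (forever if the exit rate of `Z n` is zero). -/
  path : ∀ᵐ ω ∂P, ∀ (n : ℕ) (t : ℝ), jumpTime Q Z E n ω ≤ t →
    (t - jumpTime Q Z E n ω) * exitRate Q (Z n ω) < E n ω → Y t ω = Z n ω

/-- `(Y t)`, `t ≥ 0`, is a continuous-time Markov chain with generator `Q` started at `x₀`. -/
def IsCTMC {Ω : Type*} [MeasurableSpace Ω] [MeasurableSpace S] (P : Measure Ω)
    (Q : Matrix S S ℝ) (x₀ : S) (Y : ℝ → Ω → S) : Prop :=
  (∀ t, 0 ≤ t → Measurable (Y t)) ∧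
    ∃ (Z : ℕ → Ω → S) (E : ℕ → Ω → ℝ), IsJumpHold P Q x₀ Z E Y

end CTMC

/-- The event that the process `Y` leaves the set `D` for the first time from the state `s`: up to
some time `τ > 0` it stays in `D`, at `τ` it is outside `D`, and it is at `s` just before `τ`. -/
def exitsFrom {Ω S : Type*} (D : Set S) (Y : ℝ → Ω → S) (s : S) : Set Ω :=
  {ω | ∃ τ : ℝ, 0 < τ ∧ (∀ t, 0 ≤ t → t < τ → Y t ω ∈ D) ∧ Y τ ω ∉ D ∧
    ∀ᶠ t in 𝓝[<] τ, Y t ω = s}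

/-- Long-run fraction of time during which the estimate is fresh, for the similarity map `C`. -/
def freshness {Ω S : Type*} (C : S → ℝ) (Y : ℝ → Ω → S) (ω : Ω) : ℝ :=
  limsup (fun T : ℝ => (1 / T) * ∫ t in (0 : ℝ)..T, C (Y t ω)) atTop

/-- The average freshness `𝔼[Δ]`. -/
def avgFreshness {Ω S : Type*} [MeasurableSpace Ω] (P : Measure Ω) (C : S → ℝ)
    (Y : ℝ → Ω → S) : ℝ :=
  ∫ ω, freshness C Y ω ∂P

/-! ### The Markov machine and its monitor -/

/-- States `(x, x̂)`: the actual state `x` of the machine (`0` free, `1` busy with an internal job,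
`2` busy with an external job) and the estimate `x̂`; the set is
`{0,1} × {0,1} ∪ {0,1,2} × {2}`. -/
abbrev MonState : Type := {p : Fin 3 × Fin 3 // p.2 = 2 ∨ p.1 ≠ 2}

/-- The rate of transition from `i` to `j ≠ i`, as a sum over the events that can occur:
an internal job arrives at a free machine (rate `α`), an internal job is completed (rate `β`),
an external job is completed (rate `γ`), the machine is sampled and the estimate becomes the actual
state (rate `μ`), an external job arrives (rate `lam`) when the estimate is `0` and so is sent to
the machine: it is processed if the machine is free, it is lost if the machine is busy, and in both
cases the estimate becomes the resulting actual state. -/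
def monRate (α β γ lam μ : ℝ) (i j : MonState) : ℝ :=
  (if i.1.1 = 0 ∧ j.1 = (1, i.1.2) then α else 0)
  + (if i.1.1 = 1 ∧ j.1 = (0, i.1.2) then β else 0)
  + (if i.1.1 = 2 ∧ j.1 = (0, i.1.2) then γ else 0)
  + (if j.1 = (i.1.1, i.1.1) then μ else 0)
  + (if i.1.2 = 0 ∧ j.1 = (if i.1.1 = 0 then (2, 2) else (i.1.1, i.1.1)) then lam else 0)

/-- Generator of `Y(t) = (X(t), X̂(t))`. -/
def monGen (α β γ lam μ : ℝ) : Matrix MonState MonState ℝ :=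
  generatorOf (monRate α β γ lam μ)

def s00 : MonState := ⟨(0, 0), by decide⟩
def s10 : MonState := ⟨(1, 0), by decide⟩
def s01 : MonState := ⟨(0, 1), by decide⟩
def s02 : MonState := ⟨(0, 2), by decide⟩

/-- The special similarity map:
`C(0,0) = C(1,1) = C(1,2) = C(2,2) = 1`, and zero otherwise. -/
def specialMap (i : MonState) : ℝ :=
  if i.1 = (0, 0) ∨ i.1 = (1, 1) ∨ i.1 = (1, 2) ∨ i.1 = (2, 2) then 1 else 0

end

/-!
Without sampling, the embedded chain leaves the pair `{(0,0), (1,0)}` geometrically fast, since each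
of its two states sends an external job with positive probability. From then on the estimate is `1`
forever or `2` forever, and after at most one more jump the chain alternates between a stale state
with exit rate `α` and a fresh one with exit rate `β`. By the law of large numbers for the holding
times and a renewal-reward argument, the long-run fresh fraction is almost surely
`(1 / β) / (1 / α + 1 / β) = α / (α + β)`, whatever the state from which the pair was left.

For `μ > 0` the balance equations determine a left null vector of the generator up to a scalar, so
the stationary distribution is unique. Cleared of denominators, this vector is polynomial in `μ` and
does not vanish at `μ = 0`, so the limit is found by substitution.
-/

section Averages

lemma tendsto_succ_sub_div_atTop_zero {a : ℕ → ℝ} {l : ℝ}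
    (h : Tendsto (fun n : ℕ => a n / n) atTop (𝓝 l)) :
    Tendsto (fun n : ℕ => (a (n + 1) - a n) / n) atTop (𝓝 0) := by
  have hratio : Tendsto (fun n : ℕ => ((n : ℝ) + 1) / n) atTop (𝓝 1) := by
    simpa using (tendsto_natCast_div_add_atTop (1 : ℝ)).inv₀ one_ne_zero
  have hlim := ((h.comp (tendsto_add_atTop_nat 1)).mul hratio).sub h
  rw [mul_one, sub_self] at hlim
  refine hlim.congr fun n => ?_
  simp only [Function.comp_apply, Nat.cast_add_one]
  rw [div_mul_div_cancel₀ n.cast_add_one_ne_zero, sub_div]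

lemma tendsto_average_of_shift {u : ℕ → ℝ} {l : ℝ} (N : ℕ)
    (h : Tendsto (fun n : ℕ => (∑ k ∈ Finset.range n, u (N + k)) / n) atTop (𝓝 l)) :
    Tendsto (fun n : ℕ => (∑ k ∈ Finset.range n, u k) / n) atTop (𝓝 l) := by
  rw [← tendsto_add_atTop_iff_nat N]
  have hhead : Tendsto (fun n : ℕ => (∑ k ∈ Finset.range N, u k) / ((n + N : ℕ) : ℝ)) atTop (𝓝 0) :=
    (tendsto_const_div_atTop_nhds_zero_nat _).comp (tendsto_add_atTop_nat N)
  have hlim := hhead.add (h.mul (tendsto_natCast_div_add_atTop (N : ℝ)))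
  rw [zero_add, mul_one] at hlim
  refine hlim.congr' ?_
  filter_upwards [eventually_ne_atTop 0] with n hn
  rw [add_comm n N, Finset.sum_range_add, add_div, add_comm N n, Nat.cast_add,
    div_mul_div_cancel₀ (Nat.cast_ne_zero.2 hn)]

lemma sum_range_mul_eq_sum_residues (u : ℕ → ℝ) (d m : ℕ) :
    ∑ k ∈ Finset.range (d * m), u k =
      ∑ r ∈ Finset.range d, ∑ i ∈ Finset.range m, u (d * i + r) := by
  induction m with
  | zero => simp
  | succ m ih =>
    simp only [mul_add_one, Finset.sum_range_add, ih, Finset.sum_range_succ _ m,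
      Finset.sum_add_distrib]

lemma tendsto_natCast_div_div_natCast (d : ℕ) :
    Tendsto (fun n : ℕ => ((n / d : ℕ) : ℝ) / n) atTop (𝓝 (1 / d)) := by
  refine ((tendsto_nat_floor_mul_div_atTop (R := ℝ) (a := 1 / d) (by positivity)).comp
    tendsto_natCast_atTop_atTop).congr fun n => ?_
  rw [Function.comp_apply, one_div_mul_eq_div, Nat.floor_div_natCast, Nat.floor_natCast]

lemma tendsto_average_of_residues {u x : ℕ → ℝ} {d : ℕ} (hd : 0 < d)
    (h : ∀ r < d, Tendsto (fun n : ℕ => (∑ i ∈ Finset.range n, u (d * i + r)) / n) atTop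
      (𝓝 (x r))) :
    Tendsto (fun n : ℕ => (∑ k ∈ Finset.range n, u k) / n) atTop
      (𝓝 ((∑ r ∈ Finset.range d, x r) / d)) := by
  have hblocks : Tendsto (fun m : ℕ => (∑ k ∈ Finset.range (d * m), u k) / m) atTop
      (𝓝 (∑ r ∈ Finset.range d, x r)) := by
    refine (tendsto_finsetSum _ fun r hr => h r (Finset.mem_range.1 hr)).congr fun m => ?_
    rw [sum_range_mul_eq_sum_residues, Finset.sum_div]
  have hterm : Tendsto (fun m : ℕ => (∑ r ∈ Finset.range d, |u (d * m + r)|) / m) atTop (𝓝 0) := by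
    simp only [Finset.sum_div]
    rw [← Finset.sum_const_zero (s := Finset.range d)]
    refine tendsto_finsetSum _ fun r hr => ?_
    have := (tendsto_succ_sub_div_atTop_zero (h r (Finset.mem_range.1 hr))).abs
    simpa only [Finset.sum_range_succ, add_sub_cancel_left, abs_div, Nat.abs_cast, abs_zero]
      using this
  have hrest : Tendsto (fun n : ℕ => (∑ j ∈ Finset.range (n % d), u (d * (n / d) + j)) /
      (n / d : ℕ)) atTop (𝓝 0) := by
    refine squeeze_zero_norm (fun n => ?_) (hterm.comp (Nat.tendsto_div_const_atTop hd.ne'))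
    rw [norm_div, RCLike.norm_natCast, Function.comp_apply]
    gcongr
    exact (norm_sum_le _ _).trans (Finset.sum_le_sum_of_subset_of_nonneg
      (Finset.range_mono (n.mod_lt hd).le) fun _ _ _ => abs_nonneg _)
  have hlim := ((hblocks.comp (Nat.tendsto_div_const_atTop hd.ne')).add hrest).mul
    (tendsto_natCast_div_div_natCast d)
  rw [add_zero, mul_one_div] at hlim
  refine hlim.congr' ?_
  filter_upwards [eventually_ge_atTop d] with n hn
  have hquot : ((n / d : ℕ) : ℝ) ≠ 0 := Nat.cast_ne_zero.2 (Nat.div_pos hn hd).ne'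
  rw [Function.comp_apply, ← add_div, div_mul_div_cancel₀ hquot, ← Finset.sum_range_add,
    n.div_add_mod]

lemma tendsto_average_mul_of_eventually_periodic {e w : ℕ → ℝ} {m : ℝ}
    (he : ∀ d r, 0 < d →
      Tendsto (fun n : ℕ => (∑ i ∈ Finset.range n, e (d * i + r)) / n) atTop (𝓝 m))
    {N d : ℕ} (hd : 0 < d) (hw : Function.Periodic (fun k => w (N + k)) d) :
    Tendsto (fun n : ℕ => (∑ k ∈ Finset.range n, w k * e k) / n) atTop
      (𝓝 ((∑ r ∈ Finset.range d, w (N + r) * m) / d)) := by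
  refine tendsto_average_of_shift N (tendsto_average_of_residues hd fun r _ => ?_)
  refine ((he d (N + r) hd).const_mul (w (N + r))).congr fun n => ?_
  rw [← mul_div_assoc, Finset.mul_sum]
  congr 1
  refine Finset.sum_congr rfl fun i _ => ?_
  have hper : w (N + (d * i + r)) = w (N + r) := by
    simpa [add_comm, mul_comm] using hw.nsmul i r
  rw [hper, add_left_comm N]

end Averages

/-- The path `y` visits the states `z 0, z 1, …` in turn, being at `z n` from time `J n` up to, but
excluding, time `J (n + 1)`. Nothing is required of `y` at times beyond all the `J n`. -/
structure IsStepPath {S : Type*} (J : ℕ → ℝ) (z : ℕ → S) (y : ℝ → S) : Prop where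
  zero : J 0 = 0
  strictMono : StrictMono J
  eq_of_mem_Ico : ∀ {n t}, t ∈ Set.Ico (J n) (J (n + 1)) → y t = z n

namespace IsStepPath

variable {S : Type*} {J : ℕ → ℝ} {z : ℕ → S} {y : ℝ → S}

lemma comp (h : IsStepPath J z y) {T : Type*} (C : S → T) :
    IsStepPath J (fun n => C (z n)) (fun t => C (y t)) :=
  ⟨h.zero, h.strictMono, fun ht => congrArg C (h.eq_of_mem_Ico ht)⟩

lemma exists_mem_Ico (h : IsStepPath J z y) {n : ℕ} {t : ℝ} (ht : t ∈ Set.Ico 0 (J n)) :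
    ∃ k < n, t ∈ Set.Ico (J k) (J (k + 1)) := by
  induction n with
  | zero => exact absurd (ht.1.trans_lt ht.2) (by rw [h.zero]; exact lt_irrefl 0)
  | succ n ih =>
    rcases lt_or_ge t (J n) with hlt | hge
    · obtain ⟨k, hk, hkt⟩ := ih ⟨ht.1, hlt⟩
      exact ⟨k, hk.trans n.lt_succ_self, hkt⟩
    · exact ⟨n, n.lt_succ_self, hge, ht.2⟩

lemma mem_exitsFrom {Ω : Type*} {Y : ℝ → Ω → S} {ω : Ω} (h : IsStepPath J z (Y · ω)) {D : Set S}
    {n : ℕ} (hstay : ∀ k ≤ n, z k ∈ D) (hexit : z (n + 1) ∉ D) : ω ∈ exitsFrom D Y (z n) := by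
  refine ⟨J (n + 1), h.zero ▸ h.strictMono n.succ_pos, fun t ht₀ ht => ?_, ?_, ?_⟩
  · obtain ⟨k, hk, hkt⟩ := h.exists_mem_Ico ⟨ht₀, ht⟩
    exact h.eq_of_mem_Ico hkt ▸ hstay k (Nat.lt_succ_iff.1 hk)
  · rwa [h.eq_of_mem_Ico ⟨le_rfl, h.strictMono (n + 1).lt_succ_self⟩]
  · filter_upwards [Ico_mem_nhdsLT (h.strictMono n.lt_succ_self)] with t ht
    exact h.eq_of_mem_Ico ht

variable {c : ℕ → ℝ} {f : ℝ → ℝ}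

lemma hasIntegral_holding (h : IsStepPath J c f) {n : ℕ} {T : ℝ}
    (hT : T ∈ Set.Icc (J n) (J (n + 1))) :
    IntervalIntegrable f volume (J n) T ∧ ∫ t in J n..T, f t = c n * (T - J n) := by
  have hae : ∀ᵐ t ∂volume.restrict (Set.uIoc (J n) T), c n = f t := by
    rw [Set.uIoc_of_le hT.1, ← restrict_Ico_eq_restrict_Ioc]
    filter_upwards [ae_restrict_mem measurableSet_Ico] with t ht
    exact (h.eq_of_mem_Ico ⟨ht.1, ht.2.trans_le hT.2⟩).symm
  refine ⟨(intervalIntegrable_const (c := c n)).congr_ae hae, ?_⟩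
  rw [← intervalIntegral.integral_congr_ae_restrict hae, intervalIntegral.integral_const,
    smul_eq_mul, mul_comm]

lemma integral_eq_sum_add (h : IsStepPath J c f) {n : ℕ} {T : ℝ}
    (hT : T ∈ Set.Icc (J n) (J (n + 1))) :
    ∫ t in (0 : ℝ)..T, f t =
      ∑ k ∈ Finset.range n, c k * (J (k + 1) - J k) + c n * (T - J n) := by
  have hholding := fun k : ℕ => h.hasIntegral_holding ⟨(h.strictMono k.lt_succ_self).le, le_rfl⟩
  have hsum := intervalIntegral.sum_integral_adjacent_intervals (n := n) fun k _ => (hholding k).1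
  have hint := IntervalIntegrable.trans_iterate (n := n) fun k _ => (hholding k).1
  rw [h.zero] at hsum hint
  rw [← intervalIntegral.integral_add_adjacent_intervals hint (h.hasIntegral_holding hT).1, ← hsum,
    (h.hasIntegral_holding hT).2]
  simp only [(hholding _).2]

lemma exists_jumpCount (h : IsStepPath J z y) (hJ : Tendsto J atTop atTop) :
    ∃ ν : ℝ → ℕ, Tendsto ν atTop atTop ∧ ∀ T, 0 ≤ T → T ∈ Set.Ico (J (ν T)) (J (ν T + 1)) := by
  have hex : ∀ T : ℝ, ∃ n, 0 ≤ T → T ∈ Set.Ico (J n) (J (n + 1)) := fun T => by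
    by_cases hT : 0 ≤ T
    · obtain ⟨m, hm⟩ := (hJ.eventually_gt_atTop T).exists
      obtain ⟨n, -, hn⟩ := h.exists_mem_Ico ⟨hT, hm⟩
      exact ⟨n, fun _ => hn⟩
    · exact ⟨0, fun hT' => absurd hT' hT⟩
  choose ν hν using hex
  refine ⟨ν, tendsto_atTop.2 fun m => ?_, hν⟩
  filter_upwards [eventually_ge_atTop (J m), eventually_ge_atTop 0] with T hT hT₀
  exact Nat.lt_succ_iff.1 (h.strictMono.lt_iff_lt.1 (hT.trans_lt (hν T hT₀).2))

/-- Here `q` is the mean holding time and `p` the mean of the integral of `f` over a holding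
interval. -/
lemma tendsto_timeAverage (h : IsStepPath J c f) {p q : ℝ} (hq : 0 < q)
    (hJ : Tendsto (fun n : ℕ => J n / n) atTop (𝓝 q))
    (hA : Tendsto (fun n : ℕ => (∑ k ∈ Finset.range n, c k * (J (k + 1) - J k)) / n) atTop (𝓝 p)) :
    Tendsto (fun T : ℝ => (1 / T) * ∫ t in (0 : ℝ)..T, f t) atTop (𝓝 (p / q)) := by
  have hJtop : Tendsto J atTop atTop := by
    refine (hJ.pos_mul_atTop hq tendsto_natCast_atTop_atTop).congr' ?_
    filter_upwards [eventually_ne_atTop 0] with n hn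
    exact div_mul_cancel₀ _ (Nat.cast_ne_zero.2 hn)
  obtain ⟨ν, hνtop, hν⟩ := h.exists_jumpCount hJtop
  have htime : Tendsto (fun T : ℝ => T / ν T) atTop (𝓝 q) := by
    have hJsucc : Tendsto (fun n : ℕ => J (n + 1) / n) atTop (𝓝 q) := by
      simpa [sub_div] using (tendsto_succ_sub_div_atTop_zero hJ).add hJ
    refine tendsto_of_tendsto_of_tendsto_of_le_of_le' (hJ.comp hνtop) (hJsucc.comp hνtop) ?_ ?_ <;>
      filter_upwards [eventually_ge_atTop 0] with T hT <;>
      refine div_le_div_of_nonneg_right ?_ (Nat.cast_nonneg _)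
    exacts [(hν T hT).1, (hν T hT).2.le]
  have hlast : Tendsto (fun T : ℝ => c (ν T) * (T - J (ν T)) / ν T) atTop (𝓝 0) := by
    have hbound := ((tendsto_succ_sub_div_atTop_zero hA).comp hνtop).abs
    rw [abs_zero] at hbound
    refine squeeze_zero_norm' ?_ hbound
    filter_upwards [eventually_ge_atTop 0] with T hT
    simp only [Function.comp_apply, Finset.sum_range_succ, add_sub_cancel_left, norm_div,
      Real.norm_eq_abs, abs_div, abs_mul]
    gcongr
    · exact sub_nonneg.2 (hν T hT).1
    · exact (hν T hT).2.le
  have hlim := ((hA.comp hνtop).add hlast).div htime hq.ne'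
  rw [add_zero] at hlim
  refine hlim.congr' ?_
  filter_upwards [eventually_ge_atTop 0, hνtop.eventually_ne_atTop 0] with T hT hνT
  rw [h.integral_eq_sum_add (Set.Ico_subset_Icc_self (hν T hT)), one_div_mul_eq_div]
  simp only [Function.comp_apply, Pi.div_apply]
  rw [← add_div, div_div_div_cancel_right₀ (Nat.cast_ne_zero.2 hνT)]

end IsStepPath

section GammaMeasure

variable {a r : ℝ}

lemma gammaPDFReal_mul_self (ha : 0 < a) (hr : 0 < r) (x : ℝ) :
    gammaPDFReal a r x * x = a / r * gammaPDFReal (a + 1) r x := by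
  rcases lt_or_ge x 0 with hx | hx
  · simp only [gammaPDFReal, if_neg hx.not_ge, zero_mul, mul_zero]
  · have hpow : x ^ (a - 1) * x = x ^ a := by
      rw [← Real.rpow_add_one' hx (by linarith), sub_add_cancel]
    simp only [gammaPDFReal, if_pos hx, Real.Gamma_add_one ha.ne', Real.rpow_add_one hr.ne',
      add_sub_cancel_right, ← hpow]
    field_simp [(Real.Gamma_pos_of_pos ha).ne']

lemma ae_pos_gammaMeasure : ∀ᵐ x ∂gammaMeasure a r, 0 < x := by
  simp only [ae_iff, not_lt]
  change gammaMeasure a r (Set.Iic 0) = 0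
  rw [gammaMeasure, withDensity_apply _ measurableSet_Iic,
    setLIntegral_congr Iio_ae_eq_Iic.symm, lintegral_gammaPDF_of_nonpos le_rfl]

lemma integrable_gammaPDFReal (ha : 0 < a) (hr : 0 < r) : Integrable (gammaPDFReal a r) :=
  (lintegral_ofReal_ne_top_iff_integrable (measurable_gammaPDFReal a r).aestronglyMeasurable
    (ae_of_all _ fun _ => gammaPDFReal_nonneg ha hr _)).1
    ((lintegral_gammaPDF_eq_one ha hr).trans_ne ENNReal.one_ne_top)

lemma integral_gammaPDFReal (ha : 0 < a) (hr : 0 < r) : ∫ x, gammaPDFReal a r x = 1 := by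
  rw [integral_eq_lintegral_of_nonneg_ae (ae_of_all _ fun _ => gammaPDFReal_nonneg ha hr _)
    (measurable_gammaPDFReal a r).aestronglyMeasurable]
  exact congrArg ENNReal.toReal (lintegral_gammaPDF_eq_one ha hr)

lemma integrable_id_gammaMeasure (ha : 0 < a) (hr : 0 < r) :
    Integrable (fun x => x) (gammaMeasure a r) := by
  rw [gammaMeasure, integrable_withDensity_iff_integrable_smul' (f := gammaPDF a r)
    (measurable_gammaPDFReal a r).ennreal_ofReal (ae_of_all _ fun _ => ENNReal.ofReal_lt_top)]
  refine ((integrable_gammaPDFReal (add_pos ha one_pos) hr).const_mul (a / r)).congr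
    (ae_of_all _ fun x => ?_)
  simp only [gammaPDF, ENNReal.toReal_ofReal (gammaPDFReal_nonneg ha hr x), smul_eq_mul,
    gammaPDFReal_mul_self ha hr]

lemma integral_id_gammaMeasure (ha : 0 < a) (hr : 0 < r) :
    ∫ x, x ∂gammaMeasure a r = a / r := by
  rw [gammaMeasure, integral_withDensity_eq_integral_toReal_smul (f := gammaPDF a r)
    (measurable_gammaPDFReal a r).ennreal_ofReal (ae_of_all _ fun _ => ENNReal.ofReal_lt_top)]
  simp only [gammaPDF, ENNReal.toReal_ofReal (gammaPDFReal_nonneg ha hr _), smul_eq_mul,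
    gammaPDFReal_mul_self ha hr, integral_const_mul, integral_gammaPDFReal (add_pos ha one_pos) hr,
    mul_one]

end GammaMeasure

lemma ae_tendsto_average_comp_of_injective {Ω : Type*} [MeasurableSpace Ω] {P : Measure Ω}
    {X : ℕ → Ω → ℝ} (hint : Integrable (X 0) P)
    (hindep : Pairwise fun i j => IndepFun (X i) (X j) P)
    (hident : ∀ i, IdentDistrib (X i) (X 0) P P) {g : ℕ → ℕ} (hg : Function.Injective g) :
    ∀ᵐ ω ∂P, Tendsto (fun n : ℕ => (∑ i ∈ Finset.range n, X (g i) ω) / n) atTop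
      (𝓝 (∫ ω, X 0 ω ∂P)) := by
  rw [← (hident (g 0)).integral_eq]
  exact strong_law_ae_real (fun i => X (g i)) ((hident (g 0)).integrable_iff.2 hint)
    (fun i j hij => hindep (hg.ne hij)) fun i => (hident (g i)).trans (hident (g 0)).symm

lemma ae_measure_preimage_singleton_ne_zero {Ω T : Type*} [MeasurableSpace Ω] [Countable T]
    (P : Measure Ω) (X : Ω → T) : ∀ᵐ ω ∂P, P (X ⁻¹' {X ω}) ≠ 0 := by
  have hnull : P (⋃ x ∈ {x | P (X ⁻¹' {x}) = 0}, X ⁻¹' {x}) = 0 :=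
    (measure_biUnion_null_iff (Set.to_countable _)).2 fun _ hx => hx
  refine measure_mono_null (fun ω hω => ?_) hnull
  exact Set.mem_biUnion (not_not.1 hω) rfl

lemma jumpTime_succ_sub {Ω S : Type*} {Q : Matrix S S ℝ} {Z : ℕ → Ω → S} {E : ℕ → Ω → ℝ} (n : ℕ)
    (ω : Ω) :
    jumpTime Q Z E (n + 1) ω - jumpTime Q Z E n ω = E n ω / exitRate Q (Z n ω) :=
  sub_eq_of_eq_add' (Finset.sum_range_succ _ _)

namespace IsJumpHold

variable {Ω S : Type*} [DecidableEq S] [MeasurableSpace Ω] [MeasurableSpace S]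
  {P : Measure Ω} {Q : Matrix S S ℝ} {x₀ : S} {Z : ℕ → Ω → S} {E : ℕ → Ω → ℝ} {Y : ℝ → Ω → S}

lemma ae_clock_pos (h : IsJumpHold P Q x₀ Z E Y) : ∀ᵐ ω ∂P, ∀ n, 0 < E n ω :=
  ae_all_iff.2 fun n => ae_of_ae_map (h.measurable_clock n).aemeasurable
    (h.clock_law n ▸ ae_pos_gammaMeasure)

lemma integrable_clock (h : IsJumpHold P Q x₀ Z E Y) (n : ℕ) : Integrable (E n) P := by
  have hexp : Integrable (fun x => x) (P.map (E n)) :=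
    h.clock_law n ▸ integrable_id_gammaMeasure one_pos one_pos
  exact hexp.comp_measurable (h.measurable_clock n)

lemma integral_clock (h : IsJumpHold P Q x₀ Z E Y) (n : ℕ) : ∫ ω, E n ω ∂P = 1 := by
  have hexp := integral_id_gammaMeasure one_pos one_pos
  rwa [← expMeasure, ← h.clock_law n,
    integral_map (h.measurable_clock n).aemeasurable (by fun_prop), div_one] at hexp

lemma ae_tendsto_clock_average (h : IsJumpHold P Q x₀ Z E Y) :
    ∀ᵐ ω ∂P, ∀ d r, 0 < d →
      Tendsto (fun n : ℕ => (∑ i ∈ Finset.range n, E (d * i + r) ω) / n) atTop (𝓝 1) := by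
  simp only [ae_all_iff]
  intro d r hd
  rw [← h.integral_clock 0]
  exact ae_tendsto_average_comp_of_injective (h.integrable_clock 0)
    (fun _ _ hij => h.clock_indep.indepFun hij)
    (fun i => ⟨(h.measurable_clock i).aemeasurable, (h.measurable_clock 0).aemeasurable,
      (h.clock_law i).trans (h.clock_law 0).symm⟩)
    fun _ _ hij => Nat.eq_of_mul_eq_mul_left hd (Nat.add_right_cancel hij)

lemma ae_isStepPath (h : IsJumpHold P Q x₀ Z E Y) (hQ : ∀ i, 0 < exitRate Q i) :
    ∀ᵐ ω ∂P, IsStepPath (jumpTime Q Z E · ω) (Z · ω) (Y · ω) := by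
  filter_upwards [h.path, h.ae_clock_pos] with ω hpath hE
  refine ⟨Finset.sum_range_zero _, strictMono_nat_of_lt_succ fun n => ?_, fun {n t} ht => ?_⟩
  · rw [← sub_pos, jumpTime_succ_sub]
    exact div_pos (hE n) (hQ _)
  · refine hpath n t ht.1 ?_
    rw [← lt_div_iff₀ (hQ _), ← jumpTime_succ_sub]
    exact sub_lt_sub_right ht.2 _

lemma ae_freshness_eq_of_eventually_periodic (h : IsJumpHold P Q x₀ Z E Y)
    (hQ : ∀ i, 0 < exitRate Q i) (C : S → ℝ) :
    ∀ᵐ ω ∂P, ∀ N d, 0 < d → Function.Periodic (fun k => Z (N + k) ω) d →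
      freshness C Y ω = (∑ r ∈ Finset.range d, C (Z (N + r) ω) / exitRate Q (Z (N + r) ω)) /
        ∑ r ∈ Finset.range d, 1 / exitRate Q (Z (N + r) ω) := by
  filter_upwards [h.ae_isStepPath hQ, h.ae_tendsto_clock_average] with ω hstep hE N d hd hper
  have hweighted (w : S → ℝ) :
      Tendsto (fun n : ℕ => (∑ k ∈ Finset.range n, w (Z k ω) * E k ω) / n) atTop
        (𝓝 ((∑ r ∈ Finset.range d, w (Z (N + r) ω)) / d)) := by
    simpa only [mul_one] using tendsto_average_mul_of_eventually_periodic (e := fun k => E k ω)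
      (w := fun k => w (Z k ω)) hE hd (hper.comp w)
  have hJ : Tendsto (fun n : ℕ => jumpTime Q Z E n ω / n) atTop
      (𝓝 ((∑ r ∈ Finset.range d, 1 / exitRate Q (Z (N + r) ω)) / d)) := by
    simpa only [jumpTime, one_div_mul_eq_div] using hweighted fun i => 1 / exitRate Q i
  have hA : Tendsto (fun n : ℕ => (∑ k ∈ Finset.range n,
      C (Z k ω) * (jumpTime Q Z E (k + 1) ω - jumpTime Q Z E k ω)) / n) atTop
      (𝓝 ((∑ r ∈ Finset.range d, C (Z (N + r) ω) / exitRate Q (Z (N + r) ω)) / d)) := by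
    simpa only [jumpTime_succ_sub, mul_div_assoc', div_mul_eq_mul_div]
      using hweighted fun i => C i / exitRate Q i
  have hd₀ : (0 : ℝ) < d := Nat.cast_pos.2 hd
  have hq : 0 < (∑ r ∈ Finset.range d, 1 / exitRate Q (Z (N + r) ω)) / d :=
    div_pos (Finset.sum_pos (fun _ _ => one_div_pos.2 (hQ _)) (Finset.nonempty_range_iff.2 hd.ne'))
      hd₀
  rw [freshness, ((hstep.comp C).tendsto_timeAverage hq hJ hA).limsup_eq,
    div_div_div_cancel_right₀ hd₀.ne']

lemma ae_chain [Countable S] [IsFiniteMeasure P] (h : IsJumpHold P Q x₀ Z E Y) :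
    ∀ᵐ ω ∂P, Z 0 ω = x₀ ∧ ∀ n, embeddedMatrix Q (Z n ω) (Z (n + 1) ω) ≠ 0 := by
  have hpath : ∀ᵐ ω ∂P, ∀ n, P {ω' | ∀ k ≤ n, Z k ω' = Z k ω} ≠ 0 := by
    refine ae_all_iff.2 fun n => ?_
    filter_upwards [ae_measure_preimage_singleton_ne_zero P fun ω (k : Fin (n + 1)) => Z k ω]
      with ω hω
    simpa only [Set.preimage, Set.mem_singleton_iff, funext_iff, Fin.forall_iff,
      Nat.lt_succ_iff] using hω
  filter_upwards [hpath] with ω hω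
  have hlaw : ∀ n, (if Z 0 ω = x₀ then (1 : ℝ) else 0) *
      ∏ k ∈ Finset.range n, embeddedMatrix Q (Z k ω) (Z (k + 1) ω) ≠ 0 := fun n => by
    rw [← h.chain_law n (Z · ω), measureReal_ne_zero_iff (measure_ne_top _ _)]
    exact hω n
  refine ⟨?_, fun n => ?_⟩
  · by_contra hne
    exact hlaw 0 (by rw [if_neg hne, zero_mul])
  · exact Finset.prod_ne_zero_iff.1 (right_ne_zero_of_mul (hlaw (n + 1))) n
      (Finset.self_mem_range_succ n)

lemma measureReal_path_succ (h : IsJumpHold P Q x₀ Z E Y) (n : ℕ) (z : ℕ → S) (j : S) :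
    P.real ({ω | ∀ k ≤ n, Z k ω = z k} ∩ {ω | Z (n + 1) ω = j}) =
      P.real {ω | ∀ k ≤ n, Z k ω = z k} * embeddedMatrix Q (z n) j := by
  let z' := Function.update z (n + 1) j
  have hlast : z' (n + 1) = j := Function.update_self ..
  have hold : ∀ k ≤ n, z' k = z k := fun k hk =>
    Function.update_of_ne (Nat.lt_succ_of_le hk).ne ..
  have hset : {ω | ∀ k ≤ n, Z k ω = z k} ∩ {ω | Z (n + 1) ω = j} =
      {ω | ∀ k ≤ n + 1, Z k ω = z' k} := by
    ext ω
    simp only [Set.mem_inter_iff, Set.mem_ofPred_eq, Nat.le_add_one_iff, or_imp, forall_and,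
      forall_eq, hlast]
    exact and_congr_left fun _ => forall₂_congr fun k hk => by rw [hold k hk]
  have hset' : {ω | ∀ k ≤ n, Z k ω = z k} = {ω | ∀ k ≤ n, Z k ω = z' k} := by
    ext ω
    exact forall₂_congr fun k hk => by rw [hold k hk]
  rw [hset, hset', h.chain_law, h.chain_law, Finset.prod_range_succ, hlast, hold n le_rfl,
    mul_assoc]

lemma measureReal_path_stay_le (h : IsJumpHold P Q x₀ Z E Y) (D : Finset S) (n : ℕ) (z : ℕ → S) :
    P.real ({ω | ∀ k ≤ n, Z k ω = z k} ∩ {ω | Z (n + 1) ω ∈ D}) ≤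
      P.real {ω | ∀ k ≤ n, Z k ω = z k} * ∑ j ∈ D, embeddedMatrix Q (z n) j := by
  have hcover : {ω | ∀ k ≤ n, Z k ω = z k} ∩ {ω | Z (n + 1) ω ∈ D} =
      ⋃ j ∈ D, {ω | ∀ k ≤ n, Z k ω = z k} ∩ {ω | Z (n + 1) ω = j} := by
    ext ω
    simp
  rw [hcover, Finset.mul_sum]
  simpa only [h.measureReal_path_succ] using measureReal_biUnion_finset_le (μ := P) D
    fun j => {ω | ∀ k ≤ n, Z k ω = z k} ∩ {ω | Z (n + 1) ω = j}

lemma measure_exitsFrom_pos (h : IsJumpHold P Q x₀ Z E Y) (hQ : ∀ i, 0 < exitRate Q i)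
    {D : Set S} {n : ℕ} {z : ℕ → S} (hz₀ : z 0 = x₀) (hstay : ∀ k ≤ n, z k ∈ D)
    (hexit : z (n + 1) ∉ D) (hpos : ∀ k ≤ n, 0 < embeddedMatrix Q (z k) (z (k + 1))) :
    0 < P (exitsFrom D Y (z n)) := by
  have hlaw : 0 < P.real {ω | ∀ k ≤ n + 1, Z k ω = z k} := by
    rw [h.chain_law, if_pos hz₀, one_mul]
    exact Finset.prod_pos fun k hk => hpos k (Nat.lt_succ_iff.1 (Finset.mem_range.1 hk))
  refine (ENNReal.toReal_pos_iff.1 hlaw).1.trans_le (measure_mono_ae ?_)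
  filter_upwards [h.ae_isStepPath hQ] with ω hstep hω
  have hvisit : ∀ k ≤ n + 1, Z k ω = z k := hω
  rw [← hvisit n n.le_succ]
  exact hstep.mem_exitsFrom (fun k hk => (hvisit k (hk.trans n.le_succ)).symm ▸ hstay k hk)
    ((hvisit _ le_rfl).symm ▸ hexit)

variable [IsFiniteMeasure P]

lemma measureReal_stay_succ_le [MeasurableSingletonClass S] (h : IsJumpHold P Q x₀ Z E Y)
    {D : Finset S} {θ : ℝ} (hθ : ∀ i ∈ D, ∑ j ∈ D, embeddedMatrix Q i j ≤ θ) (n : ℕ) :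
    P.real {ω | ∀ k ≤ n + 1, Z k ω ∈ D} ≤ θ * P.real {ω | ∀ k ≤ n, Z k ω ∈ D} := by
  let X : Ω → Fin (n + 1) → S := fun ω k => Z k ω
  let paths : Finset (Fin (n + 1) → S) := Fintype.piFinset fun _ => D
  have hX : Measurable X := measurable_pi_lambda _ fun k => h.measurable_chain k
  have hstay : {ω | ∀ k ≤ n, Z k ω ∈ D} = X ⁻¹' paths := by
    ext ω
    simp [X, paths, Fin.forall_iff]
  have hstay_succ : {ω | ∀ k ≤ n + 1, Z k ω ∈ D} =
      ⋃ v ∈ paths, X ⁻¹' {v} ∩ {ω | Z (n + 1) ω ∈ D} := by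
    rw [← Set.iUnion₂_inter, Finset.set_biUnion_preimage_singleton, ← hstay]
    ext ω
    simp [Nat.le_add_one_iff, or_imp, forall_and]
  have hpath (v) (hv : v ∈ paths) :
      P.real (X ⁻¹' {v} ∩ {ω | Z (n + 1) ω ∈ D}) ≤ θ * P.real (X ⁻¹' {v}) := by
    let z : ℕ → S := fun k => v (Fin.ofNat (n + 1) k)
    have hfibre : X ⁻¹' {v} = {ω | ∀ k ≤ n, Z k ω = z k} := by
      ext ω
      simp only [Set.mem_preimage, Set.mem_singleton_iff, funext_iff, Fin.forall_iff,
        Set.mem_ofPred_eq, Nat.lt_succ_iff, X, z]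
      exact forall₂_congr fun k hk => by
        rw [Fin.ofNat_val_eq_self (⟨k, Nat.lt_succ_of_le hk⟩ : Fin (n + 1))]
    rw [hfibre, mul_comm θ]
    refine (h.measureReal_path_stay_le D n z).trans ?_
    gcongr
    exact hθ _ (Fintype.mem_piFinset.1 hv _)
  calc P.real {ω | ∀ k ≤ n + 1, Z k ω ∈ D}
      ≤ ∑ v ∈ paths, P.real (X ⁻¹' {v} ∩ {ω | Z (n + 1) ω ∈ D}) :=
        hstay_succ ▸ measureReal_biUnion_finset_le _ _
    _ ≤ ∑ v ∈ paths, θ * P.real (X ⁻¹' {v}) := Finset.sum_le_sum hpath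
    _ = θ * P.real {ω | ∀ k ≤ n, Z k ω ∈ D} := by
        rw [← Finset.mul_sum, hstay,
          sum_measureReal_preimage_singleton _ fun v _ => hX (measurableSet_singleton v)]

lemma ae_exists_notMem [MeasurableSingletonClass S] (h : IsJumpHold P Q x₀ Z E Y)
    {D : Finset S} (hD : ∀ i ∈ D, ∑ j ∈ D, embeddedMatrix Q i j < 1) :
    ∀ᵐ ω ∂P, ∃ k, Z k ω ∉ D := by
  have hbound : ∀ᶠ θ in 𝓝[<] (1 : ℝ),
      (∀ i ∈ D, ∑ j ∈ D, embeddedMatrix Q i j ≤ θ) ∧ θ ∈ Set.Ico 0 1 :=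
    ((Finset.eventually_all D).2 fun i hi =>
      mem_of_superset (Ico_mem_nhdsLT (hD i hi)) fun _ hθ => hθ.1).and (Ico_mem_nhdsLT one_pos)
  obtain ⟨θ, hθ, hθ₀, hθ₁⟩ := hbound.exists
  have hgeom (n : ℕ) : P.real {ω | ∀ k ≤ n, Z k ω ∈ D} ≤ θ ^ n * P.real {ω | ∀ k ≤ 0, Z k ω ∈ D} :=
    le_geom (u := fun n => P.real {ω | ∀ k ≤ n, Z k ω ∈ D}) hθ₀ n
      fun k _ => h.measureReal_stay_succ_le hθ k
  have hmono (n : ℕ) : P.real {ω | ∀ k, Z k ω ∈ D} ≤ P.real {ω | ∀ k ≤ n, Z k ω ∈ D} :=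
    measureReal_mono (Set.ofPred_subset_ofPred.2 fun _ hω k _ => hω k)
  have hlim := (tendsto_pow_atTop_nhds_zero_of_lt_one hθ₀ hθ₁).mul_const
    (P.real {ω | ∀ k ≤ 0, Z k ω ∈ D})
  rw [zero_mul] at hlim
  have hzero : P {ω | ∀ k, Z k ω ∈ D} = 0 :=
    (measureReal_eq_zero_iff (measure_ne_top _ _)).1
      ((ge_of_tendsto' hlim fun n => (hmono n).trans (hgeom n)).antisymm measureReal_nonneg)
  simpa [ae_iff] using hzero

lemma ae_exists_exit [Countable S] [MeasurableSingletonClass S] (h : IsJumpHold P Q x₀ Z E Y)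
    {D : Finset S} (hx₀ : x₀ ∈ D) (hD : ∀ i ∈ D, ∑ j ∈ D, embeddedMatrix Q i j < 1) :
    ∀ᵐ ω ∂P, ∃ n, (∀ k ≤ n, Z k ω ∈ D) ∧ Z (n + 1) ω ∉ D := by
  filter_upwards [h.ae_chain, h.ae_exists_notMem hD] with ω hchain hex
  obtain ⟨n, hn⟩ := Nat.exists_eq_succ_of_ne_zero fun hzero : Nat.find hex = 0 =>
    Nat.find_spec hex (by rwa [hzero, hchain.1])
  exact ⟨n, fun k hk => not_not.1 (Nat.find_min hex (by omega)), by
    simpa only [hn] using Nat.find_spec hex⟩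

end IsJumpHold

section Generator

variable {S : Type*}

lemma embeddedMatrix_self [DecidableEq S] {Q : Matrix S S ℝ} {i : S} (hi : exitRate Q i ≠ 0) :
    embeddedMatrix Q i i = 0 := by
  rw [embeddedMatrix, if_neg hi, if_pos rfl]

variable [Fintype S]

lemma isStationaryDistr_iff_of_ker_eq_span {Q : Matrix S S ℝ} {w : S → ℝ} (hw : ∀ i, 0 ≤ w i)
    (hsum : 0 < ∑ i, w i) (hker : ∀ π, Matrix.vecMul π Q = 0 ↔ ∃ c : ℝ, π = c • w) (π : S → ℝ) :
    IsStationaryDistr Q π ↔ π = (∑ i, w i)⁻¹ • w := by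
  constructor
  · rintro ⟨-, hone, hbalance⟩
    obtain ⟨c, rfl⟩ := (hker π).1 hbalance
    rw [eq_inv_of_mul_eq_one_left (a := c) (by rwa [Finset.mul_sum])]
  · rintro rfl
    refine ⟨fun i => mul_nonneg (inv_nonneg.2 hsum.le) (hw i), ?_, (hker _).2 ⟨_, rfl⟩⟩
    simp only [Pi.smul_apply, smul_eq_mul]
    rw [← Finset.mul_sum, inv_mul_cancel₀ hsum.ne']

variable [DecidableEq S] (r : S → S → ℝ)

lemma generatorOf_apply_of_ne {i j : S} (hij : i ≠ j) : generatorOf r i j = r i j := if_neg hij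

lemma exitRate_generatorOf (i : S) : exitRate (generatorOf r) i = ∑ k, r i k - r i i := by
  rw [exitRate, generatorOf, if_pos rfl, neg_neg, Finset.sum_erase_eq_sub (Finset.mem_univ i)]

lemma vecMul_generatorOf (π : S → ℝ) (j : S) :
    Matrix.vecMul π (generatorOf r) j = ∑ i, π i * r i j - π j * ∑ k, r j k := by
  have hentry : ∀ i, generatorOf r i j = r i j - if i = j then ∑ k, r j k else 0 := fun i => by
    by_cases hij : i = j
    · rw [hij, if_pos rfl, ← neg_sub, ← exitRate_generatorOf, exitRate, neg_neg]
    · rw [if_neg hij, sub_zero, generatorOf_apply_of_ne r hij]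
  simp only [Matrix.vecMul, dotProduct, hentry, mul_sub, Finset.sum_sub_distrib, mul_ite, mul_zero,
    Finset.sum_ite_eq', Finset.mem_univ, if_true]

lemma embeddedMatrix_generatorOf {i : S} (hi : exitRate (generatorOf r) i ≠ 0) (j : S) :
    embeddedMatrix (generatorOf r) i j =
      if i = j then 0 else r i j / exitRate (generatorOf r) i := by
  rw [embeddedMatrix, if_neg hi]
  split_ifs with hij
  · rfl
  · rw [generatorOf_apply_of_ne r hij]

end Generator

section Machine

/-- The state of a machine known to be busy with an internal job. -/
def s11 : MonState := ⟨(1, 1), by decide⟩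

/-- The state of a machine busy with an internal job, while believed to be busy with an external
one. -/
def s12 : MonState := ⟨(1, 2), by decide⟩

/-- The state of a machine known to be busy with an external job. -/
def s22 : MonState := ⟨(2, 2), by decide⟩

lemma univ_monState : (Finset.univ : Finset MonState) = {s00, s10, s01, s11, s02, s12, s22} := by
  decide

lemma sum_monState (f : MonState → ℝ) :
    ∑ i, f i = f s00 + f s10 + f s01 + f s11 + f s02 + f s12 + f s22 := by
  rw [univ_monState]
  iterate 6 rw [Finset.sum_insert (by decide)]
  rw [Finset.sum_singleton]
  ring

lemma forall_monState {p : MonState → Prop} :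
    (∀ i, p i) ↔ p s00 ∧ p s10 ∧ p s01 ∧ p s11 ∧ p s02 ∧ p s12 ∧ p s22 := by
  simpa [← univ_monState] using
    Finset.forall_mem_insert (s := {s10, s01, s11, s02, s12, s22}) s00 p

variable {α β γ lam μ : ℝ}

lemma vecMul_monGen_eq_zero_iff {π : MonState → ℝ} :
    Matrix.vecMul π (monGen α β γ lam μ) = 0 ↔
      (α + lam) * π s00 = β * π s10 + μ * π s01 + μ * π s02 ∧
      (β + μ + lam) * π s10 = α * π s00 ∧
      (α + μ) * π s01 = β * π s11 ∧
      β * π s11 = (μ + lam) * π s10 + α * π s01 + μ * π s12 ∧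
      (α + μ) * π s02 = β * π s12 + γ * π s22 ∧
      (β + μ) * π s12 = α * π s02 ∧
      γ * π s22 = lam * π s00 := by
  rw [funext_iff, forall_monState]
  simp only [monGen, vecMul_generatorOf, sum_monState, Pi.zero_apply]
  simp only [monRate, s00, s10, s01, s11, s02, s12, s22, Prod.mk.injEq, ne_eq, Fin.isValue,
    Fin.reduceEq, zero_ne_one, one_ne_zero, and_true, and_false, and_self, if_true, if_false,
    mul_zero, add_zero, zero_add]
  constructor <;> rintro ⟨_, _, _, _, _, _, _⟩ <;> refine ⟨?_, ?_, ?_, ?_, ?_, ?_, ?_⟩ <;> linarith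

/-- The stationary distribution of the machine for `μ > 0`, up to normalization. The common
denominators are cleared, so that the weights are polynomials in `μ` that do not all vanish at
`μ = 0`. -/
noncomputable def monWeight (α β γ lam μ : ℝ) (i : MonState) : ℝ :=
  match i.1 with
  | (0, 0) => μ * β * γ * (α + β + μ) * (β + μ + lam)
  | (1, 0) => μ * α * β * γ * (α + β + μ)
  | (0, 1) => α * β * γ * ((μ + lam) * (α + β + μ) + lam * (β + μ + lam))
  | (1, 1) => α * γ * (α + μ) * ((μ + lam) * (α + β + μ) + lam * (β + μ + lam))
  | (0, 2) => lam * β * γ * (β + μ) * (β + μ + lam)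
  | (1, 2) => lam * α * β * γ * (β + μ + lam)
  | _ => lam * μ * β * (α + β + μ) * (β + μ + lam)

lemma monWeight_nonneg (hα : 0 < α) (hβ : 0 < β) (hγ : 0 < γ) (hlam : 0 < lam) (hμ : 0 ≤ μ)
    (i : MonState) : 0 ≤ monWeight α β γ lam μ i := by
  unfold monWeight
  split <;> positivity

lemma sum_monWeight_pos (hα : 0 < α) (hβ : 0 < β) (hγ : 0 < γ) (hlam : 0 < lam) (hμ : 0 ≤ μ) :
    0 < ∑ i, monWeight α β γ lam μ i := by
  refine Finset.sum_pos' (fun i _ => monWeight_nonneg hα hβ hγ hlam hμ i)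
    ⟨s12, Finset.mem_univ _, ?_⟩
  change 0 < lam * α * β * γ * (β + μ + lam)
  positivity

lemma mul_eq_mul_monWeight_of_vecMul_monGen_eq_zero {π : MonState → ℝ}
    (hπ : Matrix.vecMul π (monGen α β γ lam μ) = 0) (i : MonState) :
    monWeight α β γ lam μ s00 * π i = π s00 * monWeight α β γ lam μ i := by
  obtain ⟨-, h10, h01, h11, h02, h12, h22⟩ := vecMul_monGen_eq_zero_iff.1 hπ
  -- Balance of the flow across the boundary of `{s02, s12, s22}`.
  have hcut : μ * (π s02 + π s12) = lam * π s00 := by linear_combination h02 + h12 + h22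
  have h12' : μ * (α + β + μ) * π s12 = α * lam * π s00 := by
    linear_combination μ * h12 + α * hcut
  have h02' : μ * (α + β + μ) * π s02 = lam * (β + μ) * π s00 := by
    linear_combination (α + β + μ) * hcut - h12'
  have h01' : μ * (α + β + μ) * (β + μ + lam) * π s01 =
      α * ((μ + lam) * (α + β + μ) + lam * (β + μ + lam)) * π s00 := by
    linear_combination (α + β + μ) * (β + μ + lam) * (h01 + h11) +
      (α + β + μ) * (μ + lam) * h10 + (β + μ + lam) * h12'
  revert i
  rw [forall_monState]
  simp only [monWeight, s00, s10, s01, s11, s02, s12, s22] at h10 h01 h22 h12' h02' h01' ⊢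
  refine ⟨mul_comm _ _, ?_, ?_, ?_, ?_, ?_, ?_⟩
  · linear_combination μ * β * γ * (α + β + μ) * h10
  · linear_combination β * γ * h01'
  · linear_combination γ * (α + μ) * h01' - μ * γ * (α + β + μ) * (β + μ + lam) * h01
  · linear_combination β * γ * (β + μ + lam) * h02'
  · linear_combination β * γ * (β + μ + lam) * h12'
  · linear_combination β * μ * (α + β + μ) * (β + μ + lam) * h22

lemma vecMul_monWeight_monGen :
    Matrix.vecMul (monWeight α β γ lam μ) (monGen α β γ lam μ) = 0 := by
  rw [vecMul_monGen_eq_zero_iff]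
  simp only [monWeight, s00, s10, s01, s11, s02, s12, s22]
  refine ⟨?_, ?_, ?_, ?_, ?_, ?_, ?_⟩ <;> ring

lemma vecMul_monGen_eq_zero_iff_exists_smul (hα : 0 < α) (hβ : 0 < β) (hγ : 0 < γ) (hlam : 0 < lam)
    (hμ : 0 < μ) (π : MonState → ℝ) :
    Matrix.vecMul π (monGen α β γ lam μ) = 0 ↔ ∃ c : ℝ, π = c • monWeight α β γ lam μ := by
  constructor
  · have hw : monWeight α β γ lam μ s00 ≠ 0 := by
      change μ * β * γ * (α + β + μ) * (β + μ + lam) ≠ 0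
      positivity
    refine fun hπ => ⟨π s00 / monWeight α β γ lam μ s00, funext fun i => ?_⟩
    rw [Pi.smul_apply, smul_eq_mul, div_mul_eq_mul_div, eq_div_iff hw, mul_comm,
      mul_eq_mul_monWeight_of_vecMul_monGen_eq_zero hπ]
  · rintro ⟨c, rfl⟩
    rw [Matrix.smul_vecMul, vecMul_monWeight_monGen, smul_zero]

lemma isStationaryDistr_monGen_iff (hα : 0 < α) (hβ : 0 < β) (hγ : 0 < γ) (hlam : 0 < lam)
    (hμ : 0 < μ) {π : MonState → ℝ} :
    IsStationaryDistr (monGen α β γ lam μ) π ↔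
      π = (∑ i, monWeight α β γ lam μ i)⁻¹ • monWeight α β γ lam μ :=
  isStationaryDistr_iff_of_ker_eq_span (monWeight_nonneg hα hβ hγ hlam hμ.le)
    (sum_monWeight_pos hα hβ hγ hlam hμ.le)
    (vecMul_monGen_eq_zero_iff_exists_smul hα hβ hγ hlam hμ) π

lemma existsUnique_isStationaryDistr_monGen (hα : 0 < α) (hβ : 0 < β) (hγ : 0 < γ) (hlam : 0 < lam)
    (hμ : 0 < μ) : ∃! π : MonState → ℝ, IsStationaryDistr (monGen α β γ lam μ) π := by
  simp only [isStationaryDistr_monGen_iff hα hβ hγ hlam hμ, existsUnique_eq]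

lemma continuous_monWeight (i : MonState) : Continuous fun μ => monWeight α β γ lam μ i := by
  unfold monWeight
  split <;> fun_prop

lemma monWeight_zero_freshness (hα : 0 < α) (hβ : 0 < β) (hγ : 0 < γ) (hlam : 0 < lam) :
    1 - (monWeight α β γ lam 0 s10 + monWeight α β γ lam 0 s01 + monWeight α β γ lam 0 s02) /
      ∑ i, monWeight α β γ lam 0 i = α / (α + β) := by
  rw [sum_monState]
  simp only [monWeight, s00, s10, s01, s11, s02, s12, s22]
  field_simp
  ring

lemma tendsto_stationary_freshness (hα : 0 < α) (hβ : 0 < β) (hγ : 0 < γ) (hlam : 0 < lam)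
    {π : ℝ → MonState → ℝ}
    (hπ : ∀ μ, 0 < μ → IsStationaryDistr (monGen α β γ lam μ) (π μ)) :
    Tendsto (fun μ => 1 - (π μ s10 + π μ s01 + π μ s02)) (𝓝[>] 0) (𝓝 (α / (α + β))) := by
  have hw := continuous_monWeight (α := α) (β := β) (γ := γ) (lam := lam)
  have hcont : ContinuousAt (fun μ => 1 - (monWeight α β γ lam μ s10 + monWeight α β γ lam μ s01 +
      monWeight α β γ lam μ s02) / ∑ i, monWeight α β γ lam μ i) 0 :=
    continuousAt_const.sub ((((hw s10).add (hw s01)).add (hw s02)).continuousAt.div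
      (continuous_finsetSum _ fun i _ => hw i).continuousAt
      (sum_monWeight_pos hα hβ hγ hlam le_rfl).ne')
  rw [← monWeight_zero_freshness hα hβ hγ hlam]
  refine (hcont.tendsto.mono_left nhdsWithin_le_nhds).congr' ?_
  filter_upwards [self_mem_nhdsWithin] with μ hμ
  rw [(isStationaryDistr_monGen_iff hα hβ hγ hlam hμ).1 (hπ μ hμ)]
  simp only [Pi.smul_apply, smul_eq_mul, ← mul_add, div_eq_inv_mul]

end Machine

section NoSampling

/-- The relation between states that the machine may jump between when it is never sampled. -/
def MonStep (i j : MonState) : Prop :=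
  (i.1.1 = 0 ∧ j.1 = (1, i.1.2)) ∨ (i.1.1 = 1 ∧ j.1 = (0, i.1.2)) ∨
  (i.1.1 = 2 ∧ j.1 = (0, i.1.2)) ∨
  (i.1.2 = 0 ∧ j.1 = (if i.1.1 = 0 then (2, 2) else (i.1.1, i.1.1)))

instance : DecidableRel MonStep := fun i j => by unfold MonStep; infer_instance

/-- The union of the two closed classes of the machine that is never sampled, in which the estimate
is `1` forever or `2` forever. -/
def monRecurrent : Finset MonState := {s01, s11, s02, s12}

lemma mem_monRecurrent_of_monStep_of_notMem {i j l : MonState} (hi : i ∈ ({s00, s10} : Finset _))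
    (hj : j ∉ ({s00, s10} : Finset _)) (hij : MonStep i j) (hjl : MonStep j l) :
    l ∈ monRecurrent := by
  revert i j l
  decide

lemma mem_monRecurrent_of_monStep {i j : MonState} (hi : i ∈ monRecurrent) (hij : MonStep i j) :
    j ∈ monRecurrent := by
  revert i j
  decide

lemma eq_of_monStep_of_monStep {i j l : MonState} (hi : i ∈ monRecurrent) (hij : MonStep i j)
    (hjl : MonStep j l) : l = i := by
  revert i j l
  decide

lemma periodic_of_monStep {z : ℕ → MonState} (hz : ∀ n, MonStep (z n) (z (n + 1))) {N : ℕ}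
    (hN : z N ∈ monRecurrent) : Function.Periodic (fun k => z (N + k)) 2 := by
  have hmem : ∀ n ≥ N, z n ∈ monRecurrent := fun n hn =>
    Nat.le_induction hN (fun n _ hn => mem_monRecurrent_of_monStep hn (hz n)) n hn
  exact fun k => eq_of_monStep_of_monStep (hmem _ (Nat.le_add_right N k)) (hz (N + k))
    (hz (N + k + 1))

variable {α β γ lam : ℝ}

lemma exitRate_monGen_zero :
    exitRate (monGen α β γ lam 0) s00 = α + lam ∧ exitRate (monGen α β γ lam 0) s10 = β + lam ∧
    exitRate (monGen α β γ lam 0) s01 = α ∧ exitRate (monGen α β γ lam 0) s11 = β ∧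
    exitRate (monGen α β γ lam 0) s02 = α ∧ exitRate (monGen α β γ lam 0) s12 = β ∧
    exitRate (monGen α β γ lam 0) s22 = γ := by
  simp only [monGen, exitRate_generatorOf, sum_monState]
  simp only [monRate, s00, s10, s01, s11, s02, s12, s22, Prod.mk.injEq, ne_eq, Fin.isValue,
    Fin.reduceEq, zero_ne_one, one_ne_zero, and_true, and_false, and_self, if_true, if_false,
    add_zero, zero_add, sub_zero]

lemma exitRate_monGen_zero_pos (hα : 0 < α) (hβ : 0 < β) (hγ : 0 < γ) (hlam : 0 < lam) :
    ∀ i, 0 < exitRate (monGen α β γ lam 0) i := by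
  obtain ⟨h00, h10, h01, h11, h02, h12, h22⟩ := exitRate_monGen_zero (α := α) (β := β) (γ := γ)
    (lam := lam)
  rw [forall_monState, h00, h10, h01, h11, h02, h12, h22]
  exact ⟨add_pos hα hlam, add_pos hβ hlam, hα, hβ, hα, hβ, hγ⟩

lemma embeddedMatrix_monGen_zero (hα : 0 < α) (hβ : 0 < β) (hlam : 0 < lam) :
    embeddedMatrix (monGen α β γ lam 0) s00 s10 = α / (α + lam) ∧
    embeddedMatrix (monGen α β γ lam 0) s00 s22 = lam / (α + lam) ∧
    embeddedMatrix (monGen α β γ lam 0) s10 s00 = β / (β + lam) ∧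
    embeddedMatrix (monGen α β γ lam 0) s10 s11 = lam / (β + lam) := by
  obtain ⟨h00, h10, -⟩ := exitRate_monGen_zero (α := α) (β := β) (γ := γ) (lam := lam)
  have h00' := h00.trans_ne (add_pos hα hlam).ne'
  have h10' := h10.trans_ne (add_pos hβ hlam).ne'
  rw [monGen] at h00 h10 h00' h10' ⊢
  rw [embeddedMatrix_generatorOf _ h00', embeddedMatrix_generatorOf _ h00',
    embeddedMatrix_generatorOf _ h10', embeddedMatrix_generatorOf _ h10', h00, h10]
  simp only [monRate, s00, s10, s11, s22, Subtype.mk.injEq, Prod.mk.injEq, ne_eq, Fin.isValue,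
    Fin.reduceEq, zero_ne_one, one_ne_zero, and_true, and_false, and_self, if_true, if_false,
    add_zero, zero_add]

lemma sum_embeddedMatrix_monGen_zero_lt_one (hα : 0 < α) (hβ : 0 < β) (hlam : 0 < lam) :
    ∀ i ∈ ({s00, s10} : Finset MonState),
      ∑ j ∈ {s00, s10}, embeddedMatrix (monGen α β γ lam 0) i j < 1 := by
  obtain ⟨h00, h10, -⟩ := exitRate_monGen_zero (α := α) (β := β) (γ := γ) (lam := lam)
  have hαlam : 0 < α + lam := add_pos hα hlam
  have hβlam : 0 < β + lam := add_pos hβ hlam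
  obtain ⟨hbusy, -, hfree, -⟩ := embeddedMatrix_monGen_zero (γ := γ) hα hβ hlam
  simp only [Finset.forall_mem_insert, Finset.mem_singleton, forall_eq,
    Finset.sum_pair (show s00 ≠ s10 by decide), hbusy, hfree,
    embeddedMatrix_self (h00.trans_ne hαlam.ne'), embeddedMatrix_self (h10.trans_ne hβlam.ne'),
    zero_add, add_zero, div_lt_one hαlam, div_lt_one hβlam]
  exact ⟨lt_add_of_pos_right α hlam, lt_add_of_pos_right β hlam⟩

lemma monStep_of_embeddedMatrix_ne_zero (hα : 0 < α) (hβ : 0 < β) (hγ : 0 < γ) (hlam : 0 < lam)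
    {i j : MonState} (hij : embeddedMatrix (monGen α β γ lam 0) i j ≠ 0) : MonStep i j := by
  rw [monGen, embeddedMatrix_generatorOf _ (exitRate_monGen_zero_pos hα hβ hγ hlam i).ne'] at hij
  contrapose! hij
  simp only [MonStep, not_or] at hij
  obtain ⟨hinternal, hdone, hdone', hexternal⟩ := hij
  simp only [monRate, if_neg hinternal, if_neg hdone, if_neg hdone', if_neg hexternal, ite_self,
    add_zero, zero_div]

/-- A stale and a fresh state alternate, with mean holding times `1 / α` and `1 / β`. -/
lemma freshness_cycle (hα : 0 < α) (hβ : 0 < β) {i j : MonState} (hi : i ∈ monRecurrent)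
    (hij : MonStep i j) :
    (specialMap i / exitRate (monGen α β γ lam 0) i +
      specialMap j / exitRate (monGen α β γ lam 0) j) /
      (1 / exitRate (monGen α β γ lam 0) i + 1 / exitRate (monGen α β γ lam 0) j) =
        α / (α + β) := by
  obtain ⟨-, -, q01, q11, q02, q12, -⟩ := exitRate_monGen_zero (α := α) (β := β) (γ := γ)
    (lam := lam)
  have hcycle : (i = s01 ∧ j = s11) ∨ (i = s11 ∧ j = s01) ∨ (i = s02 ∧ j = s12) ∨
      (i = s12 ∧ j = s02) := by
    revert i j
    decide
  have c01 : specialMap s01 = 0 := if_neg (by decide)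
  have c11 : specialMap s11 = 1 := if_pos (by decide)
  have c02 : specialMap s02 = 0 := if_neg (by decide)
  have c12 : specialMap s12 = 1 := if_pos (by decide)
  rcases hcycle with ⟨rfl, rfl⟩ | ⟨rfl, rfl⟩ | ⟨rfl, rfl⟩ | ⟨rfl, rfl⟩ <;>
    simp only [q01, q11, q02, q12, c01, c11, c02, c12] <;> field_simp <;> ring

namespace IsJumpHold

variable {Ω : Type*} [MeasurableSpace Ω] {P : Measure Ω} {Z : ℕ → Ω → MonState}
  {E : ℕ → Ω → ℝ} {Y : ℝ → Ω → MonState}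

lemma ae_exists_monExit [IsFiniteMeasure P]
    (h : IsJumpHold P (monGen α β γ lam 0) s00 Z E Y)
    (hα : 0 < α) (hβ : 0 < β) (hlam : 0 < lam) :
    ∀ᵐ ω ∂P, ∃ n, (∀ k ≤ n, Z k ω ∈ ({s00, s10} : Finset _)) ∧
      Z (n + 1) ω ∉ ({s00, s10} : Finset _) :=
  h.ae_exists_exit (by decide) (sum_embeddedMatrix_monGen_zero_lt_one hα hβ hlam)

lemma ae_mem_exitsFrom_union [IsFiniteMeasure P]
    (h : IsJumpHold P (monGen α β γ lam 0) s00 Z E Y)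
    (hα : 0 < α) (hβ : 0 < β) (hγ : 0 < γ) (hlam : 0 < lam) :
    ∀ᵐ ω ∂P, ω ∈ exitsFrom {s00, s10} Y s00 ∪ exitsFrom {s00, s10} Y s10 := by
  filter_upwards [h.ae_isStepPath (exitRate_monGen_zero_pos hα hβ hγ hlam),
    h.ae_exists_monExit hα hβ hlam] with ω hstep ⟨n, hstay, hexit⟩
  simp only [Finset.mem_insert, Finset.mem_singleton] at hstay hexit
  have hmem := hstep.mem_exitsFrom (D := {s00, s10}) hstay hexit
  rcases hstay n le_rfl with hn | hn <;> rw [hn] at hmem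
  exacts [Or.inl hmem, Or.inr hmem]

lemma ae_freshness_eq [IsFiniteMeasure P] (h : IsJumpHold P (monGen α β γ lam 0) s00 Z E Y)
    (hα : 0 < α) (hβ : 0 < β) (hγ : 0 < γ) (hlam : 0 < lam) :
    freshness specialMap Y =ᵐ[P] fun _ => α / (α + β) := by
  filter_upwards [h.ae_chain, h.ae_exists_monExit hα hβ hlam,
    h.ae_freshness_eq_of_eventually_periodic (exitRate_monGen_zero_pos hα hβ hγ hlam) specialMap]
    with ω ⟨_, hchain⟩ ⟨n, hstay, hexit⟩ hfresh
  have hz : ∀ n, MonStep (Z n ω) (Z (n + 1) ω) := fun n =>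
    monStep_of_embeddedMatrix_ne_zero hα hβ hγ hlam (hchain n)
  have hN : Z (n + 2) ω ∈ monRecurrent :=
    mem_monRecurrent_of_monStep_of_notMem (hstay n le_rfl) hexit (hz n) (hz (n + 1))
  rw [hfresh (n + 2) 2 two_pos (periodic_of_monStep hz hN)]
  simp only [Finset.sum_range_succ, Finset.sum_range_zero, zero_add, add_zero]
  exact freshness_cycle hα hβ hN (hz (n + 2))

lemma measure_exitsFrom_monPair_pos
    (h : IsJumpHold P (monGen α β γ lam 0) s00 Z E Y)
    (hα : 0 < α) (hβ : 0 < β) (hγ : 0 < γ) (hlam : 0 < lam) :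
    ∀ s ∈ ({s00, s10} : Set MonState), 0 < P (exitsFrom {s00, s10} Y s) := by
  have hQ := exitRate_monGen_zero_pos hα hβ hγ hlam
  obtain ⟨hbusy, hsent, -, hlost⟩ := embeddedMatrix_monGen_zero (γ := γ) hα hβ hlam
  rintro s (rfl | rfl)
  · refine h.measure_exitsFrom_pos hQ (n := 0) (z := fun | 0 => s00 | _ => s22) rfl ?_
      (by decide) ?_ <;> rintro k hk <;> obtain rfl := Nat.le_zero.1 hk
    · exact Or.inl rfl
    · exact hsent.symm ▸ div_pos hlam (add_pos hα hlam)
  · refine h.measure_exitsFrom_pos hQ (n := 1) (z := fun | 0 => s00 | 1 => s10 | _ => s11) rfl ?_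
      (by decide) ?_ <;> rintro k hk <;> obtain rfl | rfl := Nat.le_one_iff_eq_zero_or_eq_one.1 hk
    · exact Or.inl rfl
    · exact Or.inr rfl
    · exact hbusy.symm ▸ div_pos hα (add_pos hα hlam)
    · exact hlost.symm ▸ div_pos hlam (add_pos hβ hlam)

end IsJumpHold

end NoSampling

theorem theorem3 {Ω : Type*} [MeasurableSpace Ω] (P : Measure Ω) [IsProbabilityMeasure P]
    (α β γ lam : ℝ) (hα : 0 < α) (hβ : 0 < β) (hγ : 0 < γ) (hlam : 0 < lam)
    (Y : ℝ → Ω → MonState) (hY : IsCTMC P (monGen α β γ lam 0) s00 Y) :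
    -- for `μ > 0` the stationary distribution exists and is unique
    (∀ μ : ℝ, 0 < μ → ∃! π : MonState → ℝ, IsStationaryDistr (monGen α β γ lam μ) π) ∧
    -- the average freshness at `μ = 0` is the limit of the formula for `μ > 0`
    Integrable (freshness specialMap Y) P ∧
    (∀ π : ℝ → MonState → ℝ, (∀ μ, 0 < μ → IsStationaryDistr (monGen α β γ lam μ) (π μ)) →
      Tendsto (fun μ => 1 - (π μ s10 + π μ s01 + π μ s02)) (𝓝[>] 0)
        (𝓝 (avgFreshness P specialMap Y))) ∧
    -- its value
    avgFreshness P specialMap Y = α / (α + β) ∧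
    -- the chain leaves the pair `(0,0), (1,0)`, and the value does not depend on the exit state
    (∀ᵐ ω ∂P, ω ∈ exitsFrom {s00, s10} Y s00 ∪ exitsFrom {s00, s10} Y s10) ∧
    (∀ s ∈ ({s00, s10} : Set MonState),
      0 < P (exitsFrom {s00, s10} Y s) ∧
      avgFreshness (ProbabilityTheory.cond P (exitsFrom {s00, s10} Y s)) specialMap Y
        = α / (α + β)) := by
  obtain ⟨-, Z, E, h⟩ := hY
  have hfresh := h.ae_freshness_eq hα hβ hγ hlam
  have havg : avgFreshness P specialMap Y = α / (α + β) := by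
    rw [avgFreshness, integral_congr_ae hfresh, integral_const, probReal_univ, one_smul]
  refine ⟨fun μ => existsUnique_isStationaryDistr_monGen hα hβ hγ hlam,
    (integrable_const _).congr hfresh.symm,
    fun π hπ => havg ▸ tendsto_stationary_freshness hα hβ hγ hlam hπ, havg,
    h.ae_mem_exitsFrom_union hα hβ hγ hlam, fun s hs => ?_⟩
  have hpos := h.measure_exitsFrom_monPair_pos hα hβ hγ hlam s hs
  have := cond_isProbabilityMeasure hpos.ne'
  refine ⟨hpos, ?_⟩
  rw [avgFreshness, integral_congr_ae (cond_absolutelyContinuous.ae_le hfresh), integral_const,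
    probReal_univ, one_smul]
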